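/- Let $K$ be a field with a Krull valuation $v$ (of arbitrary rank). An extension $(L|K,v)$ of the valued field $(K,v)$ is a field extension $L|K$ together with a valuation on $L$, again denoted $v$, that extends the valuation of $K$ (up to equivalence). Such an extension is called \emph{immediate} if the canonical embeddings of value groups $vK\hookrightarrow vL$ and of residue fields $Kv\hookrightarrow Lv$ are both onto, and $(K,v)$ is called \emph{maximal} if it has no immediate extension $(L|K,v)$ with $L\neq K$. A subset $B\subseteq L\setminus\{0\}$ is called \emph{$K$-valuation independent} if $$v\Big(\sum_{i=1}^n c_ib_i\Big)=\min_{1\le i\le n} v(c_ib_i)$$ for all pairwise distinct $b_1,\dots,b_n\in B$ and all $c_1,\dots,c_n\in K$; it is called a \emph{$K$-valuation basis} of a $K$-vector subspace $V\subseteq L$ if moreover $V=\mathrm{Span}_K(B)$. The extension $(L|K,v)$ is called \emph{$vs$-defectless} if every finitely generated $K$-vector subspace of $L$ has a $K$-valuation basis. Then $(K,v)$ is maximal if and only if every extension $(L|K,v)$ of $(K,v)$ is $vs$-defectless. -/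

import Mathlib

universe u v w

namespace ValuedFieldExt

section Extension

variable {K L ΓK ΓL : Type*} [Field K] [Field L] [Algebra K L]
  [LinearOrderedCommGroupWithZero ΓK] [LinearOrderedCommGroupWithZero ΓL]

/-- The extension `(L|K, v)` of valued fields is immediate: the canonical embeddings of value
groups and of residue fields are onto. The value groups (with `0` adjoined, valuations being
written multiplicatively) are the sets of values of `vL` and of the restriction of `vL` to `K`. -/
structure IsImmediate (vK : Valuation K ΓK) (vL : Valuation L ΓL) [vK.HasExtension vL] : Prop where
  valueGroup_eq : Set.range (vL.comap (algebraMap K L)) = Set.range vL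
  residueField_surjective : Function.Surjective
    (algebraMap (IsLocalRing.ResidueField vK.valuationSubring)
      (IsLocalRing.ResidueField vL.valuationSubring))

variable (K)

/-- `B ⊆ L` is `K`-valuation independent: `0 ∉ B`, and the value of every finite `K`-linear
combination of pairwise distinct elements of `B` is that of its dominant term. In the
multiplicative notation for valuations the minimum becomes a maximum (`0` for the empty sum). -/
def IsValuationIndependent (vL : Valuation L ΓL) (B : Set L) : Prop :=
  (0 : L) ∉ B ∧ ∀ (s : Finset L), (s : Set L) ⊆ B → ∀ c : L → K,
    vL (∑ b ∈ s, c b • b) = s.sup fun b => vL (c b • b)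

/-- `B` is a `K`-valuation basis of the `K`-subspace `V` of `L`. -/
def IsValuationBasis (vL : Valuation L ΓL) (V : Submodule K L) (B : Set L) : Prop :=
  IsValuationIndependent K vL B ∧ Submodule.span K B = V

/-- The extension `(L|K, v)` is vs-defectless: every finitely generated `K`-subspace of `L` has
a `K`-valuation basis. (The restriction of `vL` to `K` is determined by `vL`.) -/
def IsVSDefectless (vL : Valuation L ΓL) : Prop :=
  ∀ V : Submodule K L, V.FG → ∃ B : Set L, IsValuationBasis K vL V B

end Extension

/-- The valued field `(K, v)` is maximal: it has no proper immediate extension. Extensions in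
the universe of `K` suffice, as a proper immediate extension `L` contains, for each `a ∈ L \ K`,
the proper immediate extension `K(a)`, which is of the cardinality of a set of rational functions
over `K`; its value group is a quotient of `K(a)ˣ`. -/
def IsMaximal {K : Type u} [Field K] {ΓK : Type v} [LinearOrderedCommGroupWithZero ΓK]
    (vK : Valuation K ΓK) : Prop :=
  ∀ (L : Type u) [Field L] [Algebra K L] (ΓL : Type u) [LinearOrderedCommGroupWithZero ΓL]
    (vL : Valuation L ΓL) [vK.HasExtension vL],
    IsImmediate vK vL → Function.Surjective (algebraMap K L)

end ValuedFieldExt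

/-! An extension is immediate exactly when each nonzero `a` agrees with some element of `K` up to a
1-unit (`HasUnitApprox`). In such an extension no two elements are valuation independent, so a
valuation basis of the span of `1` and `x` has one element and `x` lies in `K`. Conversely,
maximality makes `K` spherically complete (`IsMaximal.hasBallIntersections`). This gives best
approximations in finitely generated subspaces, hence valuation bases by a Gram–Schmidt induction.
For spherical completeness, a family of balls without common point yields an element `z` of an
algebraically closed extension of an ultrapower of `K` that has no best approximation in `K`.
Kaplansky's argument (`exists_hasUnitApprox_adjoin`) turns `z` into a proper immediate extension. -/

namespace ValuedFieldExt

/-! ### Immediate extensions via 1-unit approximation -/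

section UnitApprox

variable {K L ΓK ΓL : Type*} [Field K] [Field L] [Algebra K L]
  [LinearOrderedCommGroupWithZero ΓK] [LinearOrderedCommGroupWithZero ΓL]

variable (K) in
/-- `a` agrees with an element of `K` up to a factor that is a `1`-unit. -/
def HasUnitApprox (w : Valuation L ΓL) (a : L) : Prop :=
  ∃ c : K, w (a - algebraMap K L c) < w a

theorem val_eq_of_val_sub_lt {w : Valuation L ΓL} {a c : L} (h : w (a - c) < w a) :
    w c = w a := by
  have := w.map_sub_eq_of_lt_right (x := a - c) (y := a) h
  rwa [sub_sub_cancel_left, Valuation.map_neg] at this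

theorem val_mul_sub_mul_lt {w : Valuation L ΓL} {a b c d : L} (hc : w (a - c) < w a)
    (hd : w (b - d) < w b) : w (a * b - c * d) < w (a * b) := by
  have hca := val_eq_of_val_sub_lt hc
  have ha0 : 0 < w a := zero_le.trans_lt hc
  have hb0 : 0 < w b := zero_le.trans_lt hd
  rw [show a * b - c * d = (a - c) * b + c * (b - d) by ring]
  refine w.map_add_lt ?_ ?_ <;> rw [map_mul, map_mul]
  · gcongr
  · rw [hca]; gcongr

theorem HasUnitApprox.mul {w : Valuation L ΓL} {a b : L} (ha : HasUnitApprox K w a)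
    (hb : HasUnitApprox K w b) : HasUnitApprox K w (a * b) := by
  obtain ⟨c, hc⟩ := ha
  obtain ⟨d, hd⟩ := hb
  exact ⟨c * d, by rw [map_mul (algebraMap K L)]; exact val_mul_sub_mul_lt hc hd⟩

theorem HasUnitApprox.inv {w : Valuation L ΓL} {a : L} (ha : HasUnitApprox K w a) :
    HasUnitApprox K w a⁻¹ := by
  obtain ⟨c, hc⟩ := ha
  refine ⟨c⁻¹, ?_⟩
  have hca := val_eq_of_val_sub_lt hc
  have ha0 : 0 < w a := zero_le.trans_lt hc
  have ha : a ≠ 0 := by rintro rfl; simp at ha0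
  have hc0 : algebraMap K L c ≠ 0 := by intro h; rw [h, map_zero] at hca; exact ha0.ne hca
  have : a⁻¹ - algebraMap K L c⁻¹ = -(a - algebraMap K L c) * (a⁻¹ * (algebraMap K L c)⁻¹) := by
    rw [map_inv₀]; field_simp; ring
  rw [this, map_mul, Valuation.map_neg, map_mul, map_inv₀, map_inv₀, hca]
  calc _ < w a * ((w a)⁻¹ * (w a)⁻¹) := by
        gcongr
        exact mul_pos (inv_pos.2 ha0) (inv_pos.2 ha0)
    _ = (w a)⁻¹ := by rw [mul_inv_cancel_left₀ ha0.ne']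

theorem isImmediate_of_hasUnitApprox (vK : Valuation K ΓK) (vL : Valuation L ΓL)
    [vK.HasExtension vL] (h : ∀ a : L, a ≠ 0 → HasUnitApprox K vL a) : IsImmediate vK vL where
  valueGroup_eq := by
    refine Set.Subset.antisymm (by rintro _ ⟨a, rfl⟩; exact ⟨_, rfl⟩) ?_
    rintro _ ⟨a, rfl⟩
    rcases eq_or_ne a 0 with rfl | ha
    · exact ⟨0, by simp⟩
    · obtain ⟨c, hc⟩ := h a ha
      exact ⟨c, val_eq_of_val_sub_lt hc⟩
  residueField_surjective := by
    intro r
    obtain ⟨⟨a, ha⟩, rfl⟩ := IsLocalRing.residue_surjective r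
    rcases eq_or_ne a 0 with rfl | ha0
    · exact ⟨0, by rw [map_zero]; exact (map_zero (IsLocalRing.residue vL.valuationSubring)).symm⟩
    · obtain ⟨c, hc⟩ := h a ha0
      have ha' : vL a ≤ 1 := ha
      have hc1 : vK c ≤ 1 := by
        rw [← Valuation.HasExtension.val_map_le_one_iff vK vL, val_eq_of_val_sub_lt hc]
        exact ha'
      refine ⟨IsLocalRing.residue _ ⟨c, hc1⟩, ?_⟩
      rw [Valuation.HasExtension.algebraMap_residue_eq_residue_algebraMap, eq_comm, ← sub_eq_zero,
        ← map_sub, IsLocalRing.residue_eq_zero_iff, ValuationSubring.valuation_lt_one_iff,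
        ← (Valuation.isEquiv_valuation_valuationSubring vL).lt_one_iff_lt_one]
      exact hc.trans_le ha'

theorem IsImmediate.hasUnitApprox {vK : Valuation K ΓK} {vL : Valuation L ΓL}
    [vK.HasExtension vL] (h : IsImmediate vK vL) {a : L} (ha : a ≠ 0) :
    HasUnitApprox K vL a := by
  obtain ⟨c, hc⟩ : vL a ∈ Set.range (vL.comap (algebraMap K L)) :=
    h.valueGroup_eq ▸ ⟨a, rfl⟩
  have hc : vL (algebraMap K L c) = vL a := hc
  have hva : vL a ≠ 0 := by simpa using ha
  have hc0 : c ≠ 0 := by rintro rfl; simp [hva.symm] at hc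
  have hq : vL (a / algebraMap K L c) = 1 := by rw [map_div₀, hc, div_self hva]
  obtain ⟨r, hr⟩ := h.residueField_surjective
    (IsLocalRing.residue vL.valuationSubring ⟨_, hq.le⟩)
  obtain ⟨d, rfl⟩ := IsLocalRing.residue_surjective r
  rw [Valuation.HasExtension.algebraMap_residue_eq_residue_algebraMap, eq_comm, ← sub_eq_zero,
        ← map_sub, IsLocalRing.residue_eq_zero_iff, ValuationSubring.valuation_lt_one_iff,
        ← (Valuation.isEquiv_valuation_valuationSubring vL).lt_one_iff_lt_one] at hr
  have hr : vL (a / algebraMap K L c - algebraMap K L d) < 1 := hr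
  refine ⟨d * c, ?_⟩
  have hc0' : algebraMap K L c ≠ 0 := by simpa using hc0
  have : a - algebraMap K L (d * c) =
      (a / algebraMap K L c - algebraMap K L d) * algebraMap K L c := by
    rw [map_mul]; field_simp
  rw [this, map_mul, hc]
  exact mul_lt_of_lt_one_left (zero_lt_iff.2 hva) hr

end UnitApprox

/-! ### Defectlessness implies maximality -/

section Immediate

/-- A proper immediate extension is not vs-defectless. -/
theorem surjective_of_hasUnitApprox {K L Γ : Type*} [Field K] [Field L] [Algebra K L]
    [LinearOrderedCommGroupWithZero Γ] {w : Valuation L Γ}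
    (h : ∀ a : L, a ≠ 0 → HasUnitApprox K w a) (hd : IsVSDefectless K w) :
    Function.Surjective (algebraMap K L) := by
  classical
  intro x
  obtain ⟨B, ⟨hB0, hB⟩, hspan⟩ := hd (Submodule.span K {1, x}) (Submodule.fg_span (by simp))
  have hsub : B.Subsingleton := by
    intro b hb b' hb'
    by_contra hne
    have hb0 : b ≠ 0 := fun h => hB0 (h ▸ hb)
    have hb0' : b' ≠ 0 := fun h => hB0 (h ▸ hb')
    obtain ⟨c, hc⟩ := h (b / b') (div_ne_zero hb0 hb0')
    have hlt : w (b - c • b') < w b := by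
      have h1 : b - c • b' = (b / b' - algebraMap K L c) * b' := by
        rw [Algebra.smul_def]; field_simp
      have h2 : w b = w (b / b') * w b' := by rw [← map_mul, div_mul_cancel₀ _ hb0']
      rw [h1, map_mul, h2]
      have : 0 < w b' := by simpa [zero_lt_iff] using hb0'
      gcongr
    -- Independence forbids the cancellation in `b - c • b'`.
    have := hB {b, b'} (by simp [Set.insert_subset_iff, hb, hb']) (fun z => if z = b then 1 else -c)
    rw [Finset.sum_pair hne] at this
    simp only [if_true, if_neg (Ne.symm hne), one_smul, neg_smul, ← sub_eq_add_neg] at this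
    rw [this] at hlt
    refine hlt.not_ge ?_
    simp
  have h1 : (1 : L) ∈ Submodule.span K B := hspan ▸ Submodule.subset_span (by simp)
  have hx : x ∈ Submodule.span K B := hspan ▸ Submodule.subset_span (by simp)
  rcases hsub.eq_empty_or_singleton with rfl | ⟨b, rfl⟩
  · simp at h1
  · obtain ⟨k, hk⟩ := Submodule.mem_span_singleton.1 h1
    obtain ⟨l, rfl⟩ := Submodule.mem_span_singleton.1 hx
    have hk0 : k ≠ 0 := by rintro rfl; simp at hk
    refine ⟨l / k, ?_⟩
    rw [Algebra.smul_def] at *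
    have : algebraMap K L k ≠ 0 := by simpa using hk0
    rw [map_div₀, div_eq_iff this, mul_assoc, mul_comm b, hk, mul_one]

theorem isMaximal_of_isVSDefectless {K : Type u} [Field K] {ΓK : Type v}
    [LinearOrderedCommGroupWithZero ΓK] (vK : Valuation K ΓK)
    (H : ∀ (L : Type (max u w)) [Field L] [Algebra K L] (ΓL : Type (max u w))
        [LinearOrderedCommGroupWithZero ΓL] (vL : Valuation L ΓL) [vK.HasExtension vL],
        IsVSDefectless K vL) : IsMaximal vK := by
  intro L _ _ ΓL _ vL _ himm
  let e : ULift.{w} L ≃+* L := ULift.ringEquiv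
  let v₁ : Valuation (ULift.{w} L) ΓL := vL.comap (e : ULift.{w} L →+* L)
  -- The canonical value group lives in the universe of `ULift L`, as `H` requires; `ΓL` need not.
  let v₂ := v₁.valuationSubring.valuation
  have he : v₁.IsEquiv v₂ := v₁.isEquiv_valuation_valuationSubring
  have : vK.HasExtension v₂ := ⟨fun x y =>
    ((Valuation.HasExtension.val_map_le_iff vK vL x y).symm).trans (he _ _)⟩
  have hs := surjective_of_hasUnitApprox (K := K) (w := v₂) ?_ (H _ _ v₂)
  · intro x
    obtain ⟨c, hc⟩ := hs ⟨x⟩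
    exact ⟨c, congrArg ULift.down hc⟩
  · intro a ha
    obtain ⟨c, hc⟩ := himm.hasUnitApprox (a := a.down) (fun h => ha (ULift.ext _ _ h))
    exact ⟨c, he.lt_iff_lt.1 hc⟩

end Immediate

/-! ### Best approximations and valuation bases -/

section Approximation

variable {K L Γ : Type*} [Field K] [Field L] [Algebra K L] [LinearOrderedCommGroupWithZero Γ]

/-- Every element of `L` has a best approximation in `V`. -/
def IsProximinal (w : Valuation L Γ) (V : Submodule K L) : Prop :=
  ∀ x : L, ∃ y ∈ V, ∀ y' ∈ V, w (x - y) ≤ w (x - y')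

/-- Every family of pairwise intersecting balls `{d | v (c - d) ≤ ρ c}`, one around each `c : K`,
has a common point. -/
def HasBallIntersections {K Γ : Type*} [Field K] [LinearOrderedCommGroupWithZero Γ]
    (v : Valuation K Γ) : Prop :=
  ∀ ρ : K → Γ, (∀ c c', v (c - c') ≤ max (ρ c) (ρ c')) → ∃ d, ∀ c, v (c - d) ≤ ρ c

/-- If `c • b` and `z` have equal value, a cancellation would make `-(c⁻¹ • z)` approximate `b`
better than `0` does. -/
theorem val_add_eq_max_of_le {w : Valuation L Γ} {V : Submodule K L} {b : L}
    (hb : ∀ y ∈ V, w b ≤ w (b - y)) (c : K) {z : L} (hz : z ∈ V) :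
    w (c • b + z) = max (w (c • b)) (w z) := by
  rcases eq_or_ne c 0 with rfl | hc
  · simp
  rcases ne_or_eq (w (c • b)) (w z) with h | h
  · exact w.map_add_of_distinct_val h
  · refine le_antisymm (w.map_add _ _) ?_
    rw [← h, max_self]
    have h1 : c • b + z = c • (b - (-(c⁻¹ • z))) := by
      rw [smul_sub, smul_neg, smul_inv_smul₀ hc, sub_neg_eq_add]
    rw [h1, Algebra.smul_def, Algebra.smul_def, map_mul, map_mul]
    gcongr
    exact hb _ (V.neg_mem (V.smul_mem _ hz))

/-- Let `y c` be a best approximation of `x - c • b` in `V`. The errors, divided by `w b`, are radii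
of pairwise intersecting balls in `K`; a common point is an optimal coefficient of `b`. -/
theorem IsProximinal.sup_span {w : Valuation L Γ}
    (hK : HasBallIntersections (w.comap (algebraMap K L))) {V : Submodule K L}
    (hV : IsProximinal w V) {b : L} (hb0 : b ≠ 0) (hb : ∀ y ∈ V, w b ≤ w (b - y)) :
    IsProximinal w (V ⊔ Submodule.span K {b}) := by
  intro x
  choose y hyV hy using fun c : K => hV (x - c • b)
  have hwb : w b ≠ 0 := by simpa using hb0
  obtain ⟨d, hd⟩ := hK (fun c => w (x - c • b - y c) * (w b)⁻¹) (by
    intro c c'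
    have h1 : (c - c') • b + (y c - y c') =
        -(x - c • b - y c) + (x - c' • b - y c') := by rw [sub_smul]; ring
    have h2 : w ((c - c') • b) ≤ max (w (x - c • b - y c)) (w (x - c' • b - y c')) := by
      calc _ ≤ max (w ((c - c') • b)) (w (y c - y c')) := le_max_left _ _
        _ = _ := (val_add_eq_max_of_le hb _ (V.sub_mem (hyV c) (hyV c'))).symm
        _ ≤ _ := by
          rw [h1]
          refine (w.map_add _ _).trans ?_
          rw [Valuation.map_neg]
    rw [Algebra.smul_def, map_mul] at h2
    have h3 := mul_le_mul_left h2 (w b)⁻¹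
    rw [mul_inv_cancel_right₀ hwb] at h3
    rcases le_total (w (x - c • b - y c)) (w (x - c' • b - y c')) with h | h
    · rw [max_eq_right h] at h3; exact h3.trans (le_max_right _ _)
    · rw [max_eq_left h] at h3; exact h3.trans (le_max_left _ _))
  refine ⟨d • b + y d, ?_, ?_⟩
  · rw [add_comm]
    exact Submodule.add_mem_sup (hyV d) (Submodule.smul_mem _ _ (Submodule.mem_span_singleton_self b))
  · intro z hz
    obtain ⟨z₁, hz₁, z₂, hz₂, rfl⟩ := Submodule.mem_sup.1 hz
    obtain ⟨c, rfl⟩ := Submodule.mem_span_singleton.1 hz₂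
    have h1 : w ((c - d) • b) ≤ w (x - c • b - y c) := by
      have := mul_le_mul_left (hd c) (w b)
      rw [inv_mul_cancel_right₀ hwb] at this
      rwa [Algebra.smul_def, map_mul]
    calc w (x - (d • b + y d)) = w (x - d • b - y d) := by rw [sub_sub]
      _ ≤ w (x - d • b - y c) := hy d _ (hyV c)
      _ = w ((x - c • b - y c) + (c - d) • b) := by congr 1; rw [sub_smul]; ring
      _ ≤ w (x - c • b - y c) := w.map_add_le le_rfl h1
      _ ≤ w (x - c • b - z₁) := hy c _ hz₁
      _ = _ := by congr 1; ring

theorem IsValuationBasis.insert {w : Valuation L Γ} {V : Submodule K L} {B : Set L}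
    (hB : IsValuationBasis K w V B) {b : L} (hb0 : b ≠ 0) (hb : ∀ y ∈ V, w b ≤ w (b - y)) :
    IsValuationBasis K w (V ⊔ Submodule.span K {b}) (insert b B) := by
  classical
  obtain ⟨⟨hB0, hB⟩, hspan⟩ := hB
  refine ⟨⟨by simp [hB0, hb0.symm], ?_⟩, ?_⟩
  · intro s hs c
    by_cases hbs : b ∈ s
    · have hs' : ((s.erase b : Finset L) : Set L) ⊆ B := by
        intro z hz
        rw [Finset.coe_erase] at hz
        exact (hs hz.1).resolve_left hz.2
      rw [← Finset.insert_erase hbs, Finset.sum_insert (Finset.notMem_erase b s),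
        Finset.sup_insert, val_add_eq_max_of_le hb, hB _ hs']
      rw [← hspan]
      exact Submodule.sum_mem _ fun z hz => Submodule.smul_mem _ _ (Submodule.subset_span (hs' hz))
    · exact hB s (fun z hz => (hs hz).resolve_left (by rintro rfl; exact hbs hz)) c
  · rw [Submodule.span_insert, hspan, sup_comm]

theorem isVSDefectless_of_hasBallIntersections {w : Valuation L Γ}
    (hK : HasBallIntersections (w.comap (algebraMap K L))) : IsVSDefectless K w := by
  classical
  -- Proximinality is carried along: subtracting from a new generator its best approximation makes
  -- it orthogonal to the old span.
  suffices h : ∀ s : Finset L, (∃ B, IsValuationBasis K w (Submodule.span K (s : Set L)) B) ∧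
      IsProximinal w (Submodule.span K (s : Set L)) by
    rintro V ⟨s, rfl⟩
    exact (h s).1
  intro s
  induction s using Finset.induction_on with
  | empty =>
    refine ⟨⟨∅, ⟨by simp, ?_⟩, by simp⟩, fun x => ⟨0, by simp, ?_⟩⟩
    · intro s hs c
      obtain rfl : s = ∅ := by simpa using hs
      simp [bot_eq_zero]
    · intro y hy
      have : y = 0 := by simpa using hy
      rw [this]
  | insert x s _ ih =>
    obtain ⟨⟨B, hB⟩, hV⟩ := ih
    rw [Finset.coe_insert, Submodule.span_insert, sup_comm]
    set V := Submodule.span K (s : Set L)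
    obtain ⟨y, hyV, hy⟩ := hV x
    have hsup : V ⊔ Submodule.span K {x} = V ⊔ Submodule.span K {x - y} := by
      have hle : ∀ z, V ≤ V ⊔ Submodule.span K {z} := fun z => le_sup_left
      have hmem : ∀ z, z ∈ V ⊔ Submodule.span K {z} := fun z =>
        Submodule.mem_sup_right (Submodule.mem_span_singleton_self z)
      refine le_antisymm (sup_le (hle _) ?_) (sup_le (hle _) ?_) <;>
        rw [Submodule.span_singleton_le_iff_mem]
      · simpa using Submodule.add_mem _ (hmem (x - y)) (hle _ hyV)
      · exact Submodule.sub_mem _ (hmem x) (hle _ hyV)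
    rw [hsup]
    rcases eq_or_ne (x - y) 0 with h0 | h0
    · rw [h0, Submodule.span_zero_singleton, sup_bot_eq]
      exact ⟨⟨B, hB⟩, hV⟩
    · have hb : ∀ z ∈ V, w (x - y) ≤ w (x - y - z) := fun z hz => by
        rw [sub_sub]; exact hy _ (V.add_mem hyV hz)
      exact ⟨⟨_, hB.insert h0 hb⟩, hV.sup_span hK h0 hb⟩

end Approximation

/-! ### Kaplansky's immediate simple extensions -/

section PseudoLimit

open Polynomial IntermediateField

variable {K M Γ : Type*} [Field K] [Field M] [Algebra K M] [LinearOrderedCommGroupWithZero Γ]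

variable (K) in
/-- `z'` lies closer to `z` than every element of `K`. -/
def IsCloserThan (w : Valuation M Γ) (z z' : M) : Prop :=
  ∀ d : K, w (z' - z) < w (z - algebraMap K M d)

/-- If `z` has no best approximation in `K` and no element of `s` is closer to `z` than `K`, then
some `c : K` is closer to `z' ≈ z` than all elements of `s`. -/
theorem exists_forall_val_sub_lt {w : Valuation M Γ} {z z' : M}
    (hz : ∀ d : K, ∃ c : K, w (z - algebraMap K M c) < w (z - algebraMap K M d))
    (hz' : IsCloserThan K w z z') (s : Multiset M) (hs : ∀ t ∈ s, ¬ IsCloserThan K w z t) :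
    ∃ c : K, ∀ t ∈ s, w (z' - algebraMap K M c) < w (z' - t) := by
  suffices h : ∃ c : K, ∀ t ∈ s, w (z - algebraMap K M c) < w (z' - t) by
    obtain ⟨c, hc⟩ := h
    refine ⟨c, fun t ht => lt_of_le_of_lt ?_ (hc t ht)⟩
    rw [← sub_add_sub_cancel z' z]
    exact w.map_add_le (hz' c).le le_rfl
  induction s using Multiset.induction_on with
  | empty => exact ⟨0, by simp⟩
  | cons t s ih =>
    obtain ⟨c₁, hc₁⟩ := ih fun t' ht' => hs t' (Multiset.mem_cons_of_mem ht')
    obtain ⟨c₂, hc₂⟩ : ∃ c : K, w (z - algebraMap K M c) < w (z' - t) := by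
      obtain ⟨d, hd⟩ := not_forall.1 (hs t (Multiset.mem_cons_self t s))
      obtain ⟨c, hc⟩ := hz d
      refine ⟨c, ?_⟩
      have h1 : w (z' - z) < w (t - z) := (hz' d).trans_le (not_lt.1 hd)
      rw [← sub_sub_sub_cancel_right z' t z, w.map_sub_eq_of_lt_right h1]
      exact hc.trans_le (not_lt.1 hd)
    rcases le_total (w (z - algebraMap K M c₁)) (w (z - algebraMap K M c₂)) with h | h
    · exact ⟨c₁, Multiset.forall_mem_cons.2 ⟨h.trans_lt hc₂, hc₁⟩⟩
    · exact ⟨c₂, Multiset.forall_mem_cons.2 ⟨hc₂, fun t ht => h.trans_lt (hc₁ t ht)⟩⟩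

theorem val_prod_sub_prod_lt {w : Valuation M Γ} {z c : M} (s : Multiset M)
    (h : ∀ t ∈ s, w (z - c) < w (z - t)) :
    w ((s.map (z - ·)).prod - (s.map (c - ·)).prod) < w (s.map (z - ·)).prod := by
  induction s using Multiset.induction_on with
  | empty => simp
  | cons t s ih =>
    rw [Multiset.forall_mem_cons] at h
    simp only [Multiset.map_cons, Multiset.prod_cons]
    exact val_mul_sub_mul_lt (by simpa using h.1) (ih h.2)

/-- Some `c : K` is closer to `z'` than every root of `f`, so `f(z')` and `f(c)` agree up to a
1-unit, factor by factor. -/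
theorem hasUnitApprox_aeval [IsAlgClosed M] {w : Valuation M Γ} {z z' : M}
    (hz : ∀ d : K, ∃ c : K, w (z - algebraMap K M c) < w (z - algebraMap K M d))
    (hz' : IsCloserThan K w z z') {f : K[X]} (hf : f ≠ 0)
    (hs : ∀ t ∈ f.aroots M, ¬ IsCloserThan K w z t) : HasUnitApprox K w (aeval z' f) := by
  obtain ⟨c, hc⟩ := exists_forall_val_sub_lt hz hz' _ hs
  have hsplit : (f.map (algebraMap K M)).Splits := IsAlgClosed.splits _
  refine ⟨aeval c f, ?_⟩
  rw [← aeval_algebraMap_apply, hsplit.aeval_eq_prod_aroots, hsplit.aeval_eq_prod_aroots,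
    ← mul_sub, map_mul, map_mul]
  have : 0 < w (algebraMap K M f.leadingCoeff) := by simpa [zero_lt_iff] using hf
  have := val_prod_sub_prod_lt _ hc
  gcongr

/-- Kaplansky: an element without best approximation in `K` gives an element `z'` generating
an immediate extension, with the same distances to the elements of `K`. -/
theorem exists_hasUnitApprox_adjoin [IsAlgClosed M] {w : Valuation M Γ} {z : M}
    (hz : ∀ d : K, ∃ c : K, w (z - algebraMap K M c) < w (z - algebraMap K M d)) :
    ∃ z', IsCloserThan K w z z' ∧ ∀ a ∈ K⟮z'⟯, a ≠ 0 → HasUnitApprox K w a := by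
  suffices h : ∃ z', IsCloserThan K w z z' ∧ ∀ f : K[X], aeval z' f ≠ 0 →
      ∃ g : K[X], aeval z' f = aeval z' g ∧ ∀ t ∈ g.aroots M, ¬ IsCloserThan K w z t by
    obtain ⟨z', hz', h⟩ := h
    have key : ∀ f : K[X], aeval z' f ≠ 0 → HasUnitApprox K w (aeval z' f) := by
      intro f hf
      obtain ⟨g, hg, hs⟩ := h f hf
      rw [hg] at hf ⊢
      exact hasUnitApprox_aeval hz hz' (by rintro rfl; simp at hf) hs
    refine ⟨z', hz', fun a ha ha0 => ?_⟩
    obtain ⟨r, s, rfl⟩ := (mem_adjoin_simple_iff K a).1 ha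
    rw [div_ne_zero_iff] at ha0
    rw [div_eq_mul_inv]
    exact (key r ha0.1).mul (key s ha0.2).inv
  -- Algebraic case: take `z'` of minimal degree; remainders modulo its minimal polynomial have only
  -- roots of smaller degree. Otherwise `z' = z` works.
  by_cases hP : ∃ t : M, IsIntegral K t ∧ IsCloserThan K w z t
  · obtain ⟨z', ⟨hint, hz'⟩, hmin⟩ :=
      (measure fun t : M => (minpoly K t).natDegree).wf.has_min
        {t | IsIntegral K t ∧ IsCloserThan K w z t} hP
    refine ⟨z', hz', fun f hf => ⟨f %ₘ minpoly K z', ?_, fun t ht htP => ?_⟩⟩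
    · exact (aeval_modByMonic_eq_self_of_root (minpoly.aeval K z')).symm
    · rw [mem_aroots] at ht
      refine hmin t ⟨isAlgebraic_iff_isIntegral.1 ⟨_, ht⟩, htP⟩ ?_
      refine natDegree_lt_natDegree (minpoly.ne_zero_iff.2 (isAlgebraic_iff_isIntegral.1 ⟨_, ht⟩))
        ((minpoly.degree_le_of_ne_zero K t ht.1 ht.2).trans_lt ?_)
      exact degree_modByMonic_lt _ (minpoly.monic hint)
  · push Not at hP
    refine ⟨z, fun d => ?_, fun f hf => ⟨f, rfl, fun t ht => hP t ?_⟩⟩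
    · obtain ⟨c, hc⟩ := hz d
      simpa using zero_le.trans_lt hc
    · rw [mem_aroots] at ht
      exact isAlgebraic_iff_isIntegral.1 ⟨f, ht⟩

end PseudoLimit

/-! ### Realizing an ultrafilter by a point of an extension -/

section Ultrapower

open Filter

/-- The valuation ring of an ultrapower of a valued field. -/
def ultrapowerValuationSubring {K ι Γ : Type*} [Field K] [LinearOrderedCommGroupWithZero Γ]
    (v : Valuation K Γ) (φ : Ultrafilter ι) : ValuationSubring (Germ (φ : Filter ι) K) where
  carrier := {x | x.LiftPred (v · ≤ 1)}
  mul_mem' {x y} := Germ.inductionOn₂ x y fun f g hf hg => by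
    filter_upwards [hf, hg] with t h1 h2
    simpa using mul_le_one' h1 h2
  add_mem' {x y} := Germ.inductionOn₂ x y fun f g hf hg => by
    filter_upwards [hf, hg] with t h1 h2
    exact v.map_add_le h1 h2
  zero_mem' := Germ.liftPred_const (by simp)
  one_mem' := Germ.liftPred_const (by simp)
  neg_mem' {x} := Germ.inductionOn x fun f hf => by
    filter_upwards [hf] with t h1
    simpa using h1
  mem_or_inv_mem' x := Germ.inductionOn x fun f => by
    refine (φ.eventually_or (p := fun t => v (f t) ≤ 1) (q := fun t => v (f t)⁻¹ ≤ 1)).1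
      (Eventually.of_forall fun t => ?_)
    rw [map_inv₀]
    rcases le_total (v (f t)) 1 with h | h
    · exact Or.inl h
    · exact Or.inr (inv_le_one_of_one_le₀ h)

theorem exists_isAlgClosed_extension_of_ultrafilter {K : Type u} [Field K] {Γ : Type v}
    [LinearOrderedCommGroupWithZero Γ] (v : Valuation K Γ) (φ : Ultrafilter K) :
    ∃ (M : Type u) (_ : Field M) (_ : IsAlgClosed M) (_ : Algebra K M) (B : ValuationSubring M)
      (z : M), v.HasExtension B.valuation ∧ ∀ c d : K, (∀ᶠ t in φ, v (t - c) < v (t - d)) →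
        B.valuation (z - algebraMap K M c) < B.valuation (z - algebraMap K M d) := by
  let N := Germ (φ : Filter K) K
  let A : ValuationSubring N := ultrapowerValuationSubring v φ
  let M := AlgebraicClosure N
  let i : (K → K) →+* M := (algebraMap N M).comp (Germ.coeRingHom _)
  -- `B` dominates `A`; locality of the map is what preserves strict inequalities.
  obtain ⟨B, hB, hloc⟩ := IsLocalRing.exists_factor_valuationRing
    ((algebraMap N M).comp A.subtype)
  have hle : ∀ f : K → K, (∀ᶠ t in φ, v (f t) ≤ 1) → i f ∈ B := fun f hf => hB ⟨(f : N), hf⟩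
  have hlt : ∀ f : K → K, (∀ᶠ t in φ, v (f t) < 1) → B.valuation (i f) < 1 := by
    intro f hf
    have hfA : (f : N) ∈ A := hf.mono fun _ h => h.le
    refine lt_of_le_of_ne ((B.valuation_le_one_iff _).2 (hB ⟨(f : N), hfA⟩)) fun h => ?_
    have hu : IsUnit (⟨i f, hB ⟨(f : N), hfA⟩⟩ : B) := (B.valuation_eq_one_iff _).2 h
    have hu' := hloc.map_nonunit (⟨(f : N), hfA⟩ : A) hu
    obtain ⟨⟨y, hy⟩, hxy⟩ := hu'.exists_right_inv
    have hxy : (f : N) * y = 1 := congrArg Subtype.val hxy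
    induction y using Germ.inductionOn with | _ g =>
    have hg : ∀ᶠ t in φ, v (g t) ≤ 1 := hy
    have hfg : ∀ᶠ t in φ, f t * g t = 1 := Germ.coe_eq.1 hxy
    obtain ⟨t, h1, h2, h3⟩ := (hf.and (hg.and hfg)).exists
    have := mul_lt_one_of_lt_of_le h1 h2
    rw [← map_mul, h3, map_one] at this
    exact this.false
  let _ : Algebra K M := (i.comp (Pi.constRingHom K K)).toAlgebra
  have halg : ∀ c : K, algebraMap K M c = i fun _ => c := fun c => rfl
  refine ⟨M, inferInstance, inferInstance, inferInstance, B, i id, ?_, ?_⟩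
  · refine Valuation.HasExtension.ofComapInteger (Subring.ext fun c => ?_)
    rw [Subring.mem_comap, Valuation.mem_integer_iff, Valuation.mem_integer_iff, halg]
    refine ⟨fun h => ?_,
      fun h => (B.valuation_le_one_iff _).2 (hle _ (Eventually.of_forall fun _ => h))⟩
    by_contra! hc
    have hc0 : c ≠ 0 := by rintro rfl; simp at hc
    have h1 := hlt (fun _ => c⁻¹) (Eventually.of_forall fun _ => by
      rw [map_inv₀]; exact inv_lt_one_of_one_lt₀ hc)
    have h2 := mul_lt_one_of_lt_of_le h1 h
    rw [← map_mul, ← map_mul] at h2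
    have h3 : (fun _ : K => c⁻¹) * (fun _ => c) = 1 := funext fun _ => inv_mul_cancel₀ hc0
    rw [h3, map_one, map_one] at h2
    exact h2.false
  · intro c d h
    rw [halg, halg, ← map_sub, ← map_sub]
    have h0 : ∀ᶠ t in φ, t - d ≠ 0 := h.mono fun t ht h => by
      rw [h, map_zero] at ht
      exact not_lt_zero ht
    have h1 := hlt (fun t => (t - c) / (t - d)) (h.mono fun t ht => by
      rw [map_div₀]
      exact (div_lt_one₀ (zero_le.trans_lt ht)).2 ht)
    have h2 : i (id - fun _ => c) = i (fun t => (t - c) / (t - d)) * i (id - fun _ => d) := by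
      rw [← map_mul]
      refine congrArg (algebraMap N M) (Germ.coe_eq.2 (h0.mono fun t ht => ?_))
      exact (div_mul_cancel₀ _ ht).symm
    rw [h2, map_mul]
    refine mul_lt_of_lt_one_left ?_ h1
    rw [zero_lt_iff, Valuation.ne_zero_iff]
    refine (map_ne_zero (algebraMap N M)).2 fun h => ?_
    obtain ⟨t, h3, h4⟩ := (h0.and (Germ.coe_eq.1 h)).exists
    exact h3 h4

end Ultrapower

/-! ### Maximal fields are spherically complete -/

section Maximal

open Filter

/-- In a maximal field, no element of an algebraically closed extension can fail to have a best
approximation. -/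
theorem IsMaximal.exists_best_approx {K M : Type u} [Field K] [Field M] [Algebra K M]
    [IsAlgClosed M] {Γ : Type v} [LinearOrderedCommGroupWithZero Γ] {vK : Valuation K Γ}
    (hK : IsMaximal vK) (B : ValuationSubring M) [hext : vK.HasExtension B.valuation] (z : M) :
    ∃ d : K, ∀ c : K, B.valuation (z - algebraMap K M d) ≤ B.valuation (z - algebraMap K M c) := by
  by_contra! hz
  obtain ⟨z', hz', h⟩ := exists_hasUnitApprox_adjoin hz
  let E := IntermediateField.adjoin K {z'}
  let vE : Valuation E B.ValueGroup := B.valuation.comap (algebraMap E M)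
  have : vK.HasExtension vE := ⟨hext.val_isEquiv_comap⟩
  have himm : IsImmediate vK vE := isImmediate_of_hasUnitApprox vK vE fun a ha =>
    h a a.2 (by simpa using ha)
  obtain ⟨d, hd⟩ := hK E B.ValueGroup vE himm ⟨z', IntermediateField.mem_adjoin_simple_self K z'⟩
  have hd : algebraMap K M d = z' := congrArg Subtype.val hd
  have := hz' d
  rw [← hd, Valuation.map_sub_swap] at this
  exact this.false

theorem IsMaximal.hasBallIntersections {K : Type u} [Field K] {ΓK : Type v} {Γ : Type*}
    [LinearOrderedCommGroupWithZero ΓK] [LinearOrderedCommGroupWithZero Γ]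
    {vK : Valuation K ΓK} (hK : IsMaximal vK) {v : Valuation K Γ} (hv : vK.IsEquiv v) :
    HasBallIntersections v := by
  intro ρ hρ
  by_contra! hd
  have hself : ∀ c c', ρ c ≤ ρ c' → v (c' - c) ≤ ρ c' := fun c c' h =>
    (hρ c' c).trans (max_le le_rfl h)
  let F : Filter K := ⨅ c, 𝓟 {t | v (c - t) ≤ ρ c}
  have hF : F.NeBot := by
    refine iInf_neBot_of_directed ?_ fun c => ?_
    · intro c c'
      -- Intersecting balls are nested: the smaller radius gives the smaller ball.
      wlog h : ρ c ≤ ρ c' generalizing c c'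
      · obtain ⟨e, h1, h2⟩ := this c' c (le_of_not_ge h)
        exact ⟨e, h2, h1⟩
      refine ⟨c, le_rfl, principal_mono.2 fun t (ht : v (c - t) ≤ ρ c) => ?_⟩
      have := v.map_add_le (hself c c' h) (ht.trans h)
      rwa [sub_add_sub_cancel] at this
    · rw [principal_neBot_iff]
      exact ⟨c, by simp⟩
  obtain ⟨M, _, _, _, B, z, hext, hz⟩ :=
    exists_isAlgClosed_extension_of_ultrafilter vK (Ultrafilter.of F)
  obtain ⟨d, hbest⟩ := hK.exists_best_approx B z
  -- The best approximation `d` misses the ball around some `c`, so every point of that ball, hence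
  -- `z`, is closer to `c` than to `d`.
  obtain ⟨c, hc⟩ := hd d
  refine (hz c d ?_).not_ge (hbest c)
  have hmem : {t | v (c - t) ≤ ρ c} ∈ F := mem_iInf_of_mem c (mem_principal_self _)
  filter_upwards [Ultrafilter.of_le F hmem] with t ht
  rw [hv.lt_iff_lt, v.map_sub_swap t c, ← sub_sub_sub_cancel_left d t c]
  have h1 : v (c - t) < v (c - d) := lt_of_le_of_lt ht hc
  rwa [v.map_sub_eq_of_lt_left h1]

end Maximal
end ValuedFieldExt

theorem mainTheorem9 {K : Type u} [Field K] {ΓK : Type v} [LinearOrderedCommGroupWithZero ΓK]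
    (vK : Valuation K ΓK) :
    ValuedFieldExt.IsMaximal vK ↔
      ∀ (L : Type (max u w)) [Field L] [Algebra K L] (ΓL : Type (max u w))
        [LinearOrderedCommGroupWithZero ΓL] (vL : Valuation L ΓL) [vK.HasExtension vL],
        ValuedFieldExt.IsVSDefectless K vL :=
  ⟨fun hK _ _ _ _ _ _ _ => ValuedFieldExt.isVSDefectless_of_hasBallIntersections
      (hK.hasBallIntersections Valuation.HasExtension.val_isEquiv_comap),
    fun H => ValuedFieldExt.isMaximal_of_isVSDefectless vK H⟩
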